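/- There is a universal constant $C>0$ with the following property. Let $n,m\ge 0$ be integers, let $M$ be a set of $m$ goods, and for each buyer $i\in\{1,\dots,n\}$ let $\mathcal D_i$ be a probability distribution over subadditive valuation functions, that is, functions $v:2^M\to\mathbb R_{\ge 0}$ with $v(\emptyset)=0$, $v(S)\le v(T)$ for $S\subseteq T$, and $v(S\cup T)\le v(S)+v(T)$ for all $S,T\subseteq M$. Let $\mathcal D=\prod_i\mathcal D_i$, so that the valuations are independent across buyers. Then there is a vector of item prices $p\in\mathbb R_{\ge 0}^{M}$, depending only on $\mathcal D$, such that the following holds. Consider the sequential posted-price mechanism with the static and anonymous item prices $p$: the buyers arrive one by one, in an arbitrary order that is fixed in advance and that need not be known when $p$ is chosen, and each arriving buyer $i$ buys a set $\mathrm{ALG}_i(\mathbf v)$ that maximizes $v_i(S)-\sum_{j\in S}p_j$ among all sets $S$ of unsold goods. Ties may be broken arbitrarily (measurably), as long as the choice depends only on the valuations of buyers who have already arrived, including $i$. Then $$\mathbb E_{\mathbf v\sim\mathcal D}\Big[\max_{\mathbf x}\sum_{i=1}^n v_i(x_i)\Big]\;\le\; C\cdot\max\{1,\log\log m\}\cdot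 \mathbb E_{\mathbf v\sim\mathcal D}\Big[\sum_{i=1}^n v_i(\mathrm{ALG}_i(\mathbf v))\Big],$$ where the maximum is over all allocations $\mathbf x=(x_1,\dots,x_n)$ of pairwise disjoint subsets of $M$, $\log$ is the natural logarithm, $\log\log m$ is read as $0$ for $m\le 1$, and the expectations take values in $[0,\infty]$. In other words, static anonymous item prices are $O(\log\log m)$-competitive with the expected optimal welfare. -/

import Mathlib

open MeasureTheory
open scoped NNReal ENNReal

noncomputable section

namespace Auction

/-- `v` is a normalized, monotone and subadditive set function on the goods `Fin m`. -/
structure IsSubadditiveValuation {m : ℕ} (v : Finset (Fin m) → ℝ≥0) : Prop where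
  normalized : v ∅ = 0
  monotone : ∀ S T : Finset (Fin m), S ⊆ T → v S ≤ v T
  subadditive : ∀ S T : Finset (Fin m), v (S ∪ T) ≤ v S + v T

/-- The space of subadditive valuations of `m` goods. As a subtype of a finite power of `ℝ≥0` it
carries the Borel σ-algebra of that power. -/
abbrev Valuation (m : ℕ) : Type :=
  {v : Finset (Fin m) → ℝ≥0 // IsSubadditiveValuation v}

/-- A valuation profile of `n` buyers. -/
abbrev Profile (n m : ℕ) : Type := Fin n → Valuation m

/-- No good is assigned more than once. -/
def IsAllocation {n m : ℕ} (x : Fin n → Finset (Fin m)) : Prop :=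
  ∀ i k : Fin n, i ≠ k → Disjoint (x i) (x k)

/-- The welfare of an assignment of sets of goods to the buyers. -/
def welfare {n m : ℕ} (v : Profile n m) (x : Fin n → Finset (Fin m)) : ℝ≥0 :=
  ∑ i, (v i).1 (x i)

open Classical in
/-- The welfare of a welfare-maximizing allocation: a maximum over the finite, nonempty set of
all allocations. -/
def optWelfare {n m : ℕ} (v : Profile n m) : ℝ≥0 :=
  (Finset.univ.filter
    (fun x : Fin n → Finset (Fin m) => IsAllocation x)).sup (fun x => welfare v x)

/-- The utility of a buyer with valuation `v` who buys the set `S` at the item prices `p`. -/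
def utility {m : ℕ} (p : Fin m → ℝ≥0) (v : Valuation m) (S : Finset (Fin m)) : ℝ :=
  (v.1 S : ℝ) - ∑ j ∈ S, (p j : ℝ)

/-- The goods that are unsold when buyer `i` arrives, if the buyers get the sets `x`. Buyer `k`
arrives at position `σ k`. -/
def unsold {n m : ℕ} (σ : Equiv.Perm (Fin n)) (x : Fin n → Finset (Fin m)) (i : Fin n) :
    Finset (Fin m) :=
  Finset.univ.filter (fun j => ∀ k : Fin n, σ k < σ i → j ∉ x k)

/-- `alg` is a possible behaviour of the sequential posted-price mechanism with the static
anonymous item prices `p` and the arrival order `σ`: it maps each valuation profile to the sets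
that the buyers buy. Ties between utility-maximizing sets may be broken in any way that does not
depend on the valuations of buyers who have not arrived yet (and that is measurable). -/
structure IsPostedPriceOutcome {n m : ℕ} (p : Fin m → ℝ≥0) (σ : Equiv.Perm (Fin n))
    (alg : Profile n m → Fin n → Finset (Fin m)) : Prop where
  /-- A buyer buys unsold goods only. -/
  feasible : ∀ v i, alg v i ⊆ unsold σ (alg v) i
  /-- What a buyer buys maximizes her utility among all sets of unsold goods. -/
  maximizes : ∀ v i, ∀ S ⊆ unsold σ (alg v) i, utility p (v i) S ≤ utility p (v i) (alg v i)
  /-- What a buyer buys is determined by the valuations of the buyers who have arrived. -/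
  online : ∀ v w : Profile n m, ∀ i, (∀ k, σ k ≤ σ i → v k = w k) → alg v i = alg w i
  /-- The outcome is a measurable function of the valuations. -/
  measurable : ∀ i, ∀ S : Finset (Fin m), MeasurableSet {v : Profile n m | alg v i = S}

/-- The sets of goods of `A` that maximize the utility. -/
def demand {m : ℕ} (p : Fin m → ℝ≥0) (A : Finset (Fin m)) (v : Valuation m) :
    Set (Finset (Fin m)) :=
  {S | S ⊆ A ∧ ∀ T ⊆ A, utility p v T ≤ utility p v S}

theorem demand_nonempty {m : ℕ} (p : Fin m → ℝ≥0) (A : Finset (Fin m)) (v : Valuation m) :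
    (demand p A v).Nonempty := by
  obtain ⟨S, hS, h⟩ := A.powerset.exists_max_image (utility p v) ⟨∅, by simp⟩
  exact ⟨S, Finset.mem_powerset.1 hS, fun T hT => h T (Finset.mem_powerset.2 hT)⟩

theorem measurable_utility {m : ℕ} (p : Fin m → ℝ≥0) (S : Finset (Fin m)) :
    Measurable (fun v : Valuation m => utility p v S) := by
  have h : Measurable (fun v : Valuation m => v.1 S) :=
    (measurable_pi_apply S).comp measurable_subtype_coe
  exact (h.coe_nnreal_real).sub_const _

/-- For all prices and every arrival order the posted-price mechanism can be run: the conditions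
on its behaviour can be satisfied. -/
theorem exists_isPostedPriceOutcome {n m : ℕ} (p : Fin m → ℝ≥0) (σ : Equiv.Perm (Fin n)) :
    ∃ alg : Profile n m → Fin n → Finset (Fin m), IsPostedPriceOutcome p σ alg := by
  classical
  let _ : MeasurableSpace (Finset (Fin m)) := ⊤
  let _ : MeasurableSpace (Set (Finset (Fin m))) := ⊤
  let g : Set (Finset (Fin m)) → Finset (Fin m) := fun s => if h : s.Nonempty then h.some else ∅
  let pick : Finset (Fin m) → Valuation m → Finset (Fin m) := fun A v => g (demand p A v)
  have pick_mem : ∀ A v, pick A v ∈ demand p A v := by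
    intro A v
    have h := demand_nonempty p A v
    change g (demand p A v) ∈ _
    simp only [g, dif_pos h]
    exact h.some_mem
  have meas_demand : ∀ A, Measurable (fun v => demand p A v) := by
    intro A
    refine measurable_to_countable' fun s => ?_
    have : (fun v => demand p A v) ⁻¹' {s} = ⋂ S : Finset (Fin m),
        {v | (S ⊆ A ∧ ∀ T, T ⊆ A → utility p v T ≤ utility p v S) ↔ S ∈ s} := by
      ext v
      simp [demand, Set.ext_iff]
    rw [this]
    refine MeasurableSet.iInter fun S => ?_
    have h1 : MeasurableSet {v : Valuation m | ∀ T, T ⊆ A → utility p v T ≤ utility p v S} := by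
      simp only [Set.ofPred_forall]
      exact MeasurableSet.iInter fun T => MeasurableSet.iInter fun _ =>
        measurableSet_le (measurable_utility p T) (measurable_utility p S)
    exact ((MeasurableSet.const _).inter h1).iff (MeasurableSet.const _)
  have meas_pick : ∀ A, Measurable (pick A) := fun A =>
    (measurable_from_top (f := g)).comp (meas_demand A)
  let sold : ℕ → Profile n m → Finset (Fin m) := fun t v =>
    Nat.rec ∅ (fun s X => if h : s < n then X ∪ pick Xᶜ (v (σ.symm ⟨s, h⟩)) else X) t
  have sold_succ : ∀ (i : Fin n) v, sold (σ i + 1) v =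
      sold (σ i) v ∪ pick (sold (σ i) v)ᶜ (v i) := by
    intro i v
    simp [sold]
  let alg : Profile n m → Fin n → Finset (Fin m) := fun v i => pick (sold (σ i) v)ᶜ (v i)
  have mem_sold : ∀ t v j, t ≤ n → (j ∈ sold t v ↔ ∃ k : Fin n, (σ k : ℕ) < t ∧ j ∈ alg v k) := by
    intro t v j
    induction t with
    | zero => intro _; simp [sold]
    | succ t ih =>
      intro ht
      have e : ((σ (σ.symm ⟨t, ht⟩) : Fin n) : ℕ) = t := by simp
      have h1 := sold_succ (σ.symm ⟨t, ht⟩) v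
      rw [e] at h1
      rw [h1, Finset.mem_union, ih (by omega)]
      constructor
      · rintro (⟨k, hk, hj⟩ | hj)
        · exact ⟨k, by omega, hj⟩
        · refine ⟨σ.symm ⟨t, ht⟩, by omega, ?_⟩
          simpa only [alg, e] using hj
      · rintro ⟨k, hk, hj⟩
        rcases Nat.lt_succ_iff_lt_or_eq.1 hk with hlt | heq
        · exact Or.inl ⟨k, hlt, hj⟩
        · right
          have : k = σ.symm ⟨t, ht⟩ := by
            rw [Equiv.eq_symm_apply]; exact Fin.ext heq
          subst this
          simpa only [alg, e] using hj
  have unsold_eq : ∀ v i, unsold σ (alg v) i = (sold (σ i) v)ᶜ := by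
    intro v i
    ext j
    simp only [unsold, Finset.mem_filter, Finset.mem_univ, true_and, Finset.mem_compl,
      mem_sold _ v j (σ i).2.le, not_exists, not_and, Fin.lt_def]
  have meas_sold : ∀ t, Measurable (sold t) := by
    intro t
    induction t with
    | zero => exact measurable_const
    | succ t ih =>
      by_cases h : t < n
      · refine measurable_to_countable' fun S => ?_
        have : sold (t + 1) ⁻¹' {S} = ⋃ X : Finset (Fin m),
            {v | sold t v = X ∧ X ∪ pick Xᶜ (v (σ.symm ⟨t, h⟩)) = S} := by
          ext v
          simp [sold, h]
        rw [this]
        refine MeasurableSet.iUnion fun X => MeasurableSet.inter ?_ ?_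
        · exact ih (measurableSet_singleton X)
        · exact ((measurable_from_top (f := fun Y => X ∪ Y)).comp
            ((meas_pick Xᶜ).comp (measurable_pi_apply (σ.symm ⟨t, h⟩)))) (measurableSet_singleton S)
      · have : sold (t + 1) = sold t := by
          funext v
          simp [sold, h]
        rw [this]
        exact ih
  refine ⟨alg, ?_, ?_, ?_, ?_⟩
  · intro v i
    rw [unsold_eq]
    exact (pick_mem _ _).1
  · intro v i S hS
    rw [unsold_eq] at hS
    exact (pick_mem _ _).2 S hS
  · intro v w i h
    have key : ∀ t, t ≤ (σ i : ℕ) → sold t v = sold t w := by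
      intro t
      induction t with
      | zero => intro _; rfl
      | succ t ih =>
        intro ht
        have hn : t < n := by have := (σ i).2; omega
        have e : ((σ (σ.symm ⟨t, hn⟩) : Fin n) : ℕ) = t := by simp
        have h1 := sold_succ (σ.symm ⟨t, hn⟩) v
        have h2 := sold_succ (σ.symm ⟨t, hn⟩) w
        rw [e] at h1 h2
        rw [h1, h2, ih (by omega), h (σ.symm ⟨t, hn⟩) (by rw [Fin.le_def]; omega)]
    change pick (sold (σ i) v)ᶜ (v i) = pick (sold (σ i) w)ᶜ (w i)
    rw [key _ le_rfl, h i le_rfl]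
  · intro i S
    have : {v : Profile n m | alg v i = S} = ⋃ X : Finset (Fin m),
        {v | sold (σ i) v = X ∧ pick Xᶜ (v i) = S} := by
      ext v
      simp [alg]
    rw [this]
    refine MeasurableSet.iUnion fun X => MeasurableSet.inter ?_ ?_
    · exact meas_sold _ (measurableSet_singleton X)
    · exact ((meas_pick Xᶜ).comp (measurable_pi_apply i)) (measurableSet_singleton S)

end Auction

end

/-! Fix a welfare-maximizing allocation `x`, let O be its expected welfare, and write p(T) for the
total price of T. A strategy at scale q gives buyer i a random subset of `x w i` that contains each
good with probability at most q. Let V(q) be the supremum of the expected welfare over such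
strategies.

Gap. Handing out `x w i` with probability 1/2 shows V(1/2) ≥ O/2, while V(q) ≤ q m O because a
subadditive value is at most the sum of its singleton values. Squaring the scale K times from 1/2
reaches a scale of at most 1/(4m) once K is of order log log m, so along the way some squaring costs
more than δ = O/(8K): there is a strategy at scale q with welfare W > V(q²) + δ
(`exists_strategy_gap`).

Prices. Let T be a random set, independent of the strategy, that contains each good with probability
at most q. Intersecting the strategy with T gives a strategy at scale q², so by subadditivity
removing T leaves welfare more than δ. Linear duality turns this statement about all such T into
prices p with δ + q p(M) ≤ W(without T) + p(T) for every fixed set T (`IsStrategy.exists_prices`).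

Mechanism. Buyer i could resample the other valuations, draw S from the strategy and buy the unsold
part of S. What is unsold when i arrives does not depend on her own valuation, so this deviation
behaves like the strategy on an independent profile. All deviations together cost at most q p(M) in
expectation, and their value is at least W(without T) for T the goods sold in the end. The revenue
is p(T), so adding it to the utilities gives welfare at least δ
(`IsPostedPriceOutcome.le_lintegral_welfare`).

These subtractions need O finite; infinite O is treated separately. -/

namespace Auction

/-! ### Prices from a separating hyperplane -/

/-- Prices dual to the constraint that every good is covered with probability at most `q`. -/
theorem exists_prices_of_forall_lt {m : ℕ} (F : Finset (Fin m) → ℝ) {q β : ℝ} (hq : 0 ≤ q)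
    (h : ∀ μ ∈ stdSimplex ℝ (Finset (Fin m)),
      (∀ j, ∑ T, μ T * (if j ∈ T then 1 else 0) ≤ q) → β < ∑ T, μ T * F T) :
    ∃ p : Fin m → ℝ≥0, ∀ T, β + q * ∑ j, (p j : ℝ) ≤ F T + ∑ j ∈ T, (p j : ℝ) := by
  let L : (Finset (Fin m) → ℝ) →ₗ[ℝ] ℝ × (Fin m → ℝ) :=
    { toFun := fun μ => (∑ T, μ T * F T, fun j => ∑ T, μ T * (if j ∈ T then 1 else 0))
      map_add' := fun x y => by
        ext <;> simp only [Pi.add_apply, add_mul, Finset.sum_add_distrib, Prod.mk_add_mk]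
      map_smul' := fun c x => by
        ext <;> simp only [Pi.smul_apply, smul_eq_mul, mul_assoc, Finset.mul_sum, Prod.smul_mk,
          RingHom.id_apply] }
  let s := L '' stdSimplex ℝ (Finset (Fin m))
  -- If this orthant met the image of the simplex, some law with coverage at most `q` would have
  -- expected `F` at most `β`, against `h`.
  let t : Set (ℝ × (Fin m → ℝ)) := Set.Iic (β, fun _ => q)
  have hs : Convex ℝ s := (convex_stdSimplex ℝ _).linear_image L
  have hs' : IsCompact s := (isCompact_stdSimplex ℝ _).image L.continuous_of_finiteDimensional
  have hd : Disjoint s t := by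
    rw [Set.disjoint_left]
    rintro _ ⟨μ, hμ, rfl⟩ ⟨h1, h2⟩
    exact absurd h1 (not_le.2 (h μ hμ h2))
  obtain ⟨f, u, u', hfs, huu, hft⟩ :=
    geometric_hahn_banach_compact_closed hs hs' (convex_Iic _) isClosed_Iic hd
  have hf : ∀ (a : ℝ) (b : Fin m → ℝ),
      f (a, b) = a * f (1, 0) + ∑ j, b j * f (0, Pi.single j 1) := by
    intro a b
    have e : ((a, b) : ℝ × (Fin m → ℝ)) =
        a • ((1, 0) : ℝ × (Fin m → ℝ)) + ∑ j, b j • ((0, Pi.single j 1) : ℝ × (Fin m → ℝ)) := by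
      ext k
      · simp [Prod.fst_sum]
      · simp [Prod.snd_sum, Finset.sum_apply, Pi.single_apply]
    conv_lhs => rw [e]
    simp only [map_add, map_sum, map_smul, smul_eq_mul]
  set c := f (1, 0)
  set d : Fin m → ℝ := fun j => f (0, Pi.single j 1)
  have hft' : ∀ a ≤ β, ∀ b : Fin m → ℝ, (∀ j, b j ≤ q) → u' < a * c + ∑ j, b j * d j := by
    intro a ha b hb
    rw [← hf]
    exact hft _ ⟨ha, hb⟩
  have hfs' : ∀ T, F T * c + ∑ j ∈ T, d j < u := by
    intro T
    have h1 := hfs _ ⟨Pi.single T 1, single_mem_stdSimplex ℝ T, rfl⟩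
    have h2 : L (Pi.single T 1) = (F T, fun j => if j ∈ T then 1 else 0) := by
      refine Prod.ext ?_ (funext fun j => ?_)
      all_goals
        simp only [L, LinearMap.coe_mk, AddHom.coe_mk]
        rw [Finset.sum_eq_single T] <;> simp +contextual
    rw [h2, hf] at h1
    simpa using h1
  have hβ := hft' β le_rfl (fun _ => q) (fun _ => le_rfl)
  -- The functional is bounded below on the orthant, which is unbounded downwards in every
  -- coordinate; hence all its coefficients are nonpositive.
  have hc : c ≤ 0 := by
    by_contra! hc
    obtain ⟨a, ha⟩ : ∃ a : ℝ, 0 ≤ a ∧ β * c + ∑ j, q * d j - u' ≤ a * c :=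
      ⟨|β * c + ∑ j, q * d j - u'| / c, by positivity, by
        rw [div_mul_cancel₀ _ hc.ne']; exact le_abs_self _⟩
    have := hft' (β - a) (by linarith) (fun _ => q) (fun _ => le_rfl)
    nlinarith
  have hdj : ∀ j, d j ≤ 0 := by
    intro j
    by_contra! hj
    obtain ⟨a, ha, ha'⟩ : ∃ a : ℝ, 0 ≤ a ∧ β * c + ∑ j, q * d j - u' ≤ a * d j :=
      ⟨|β * c + ∑ j, q * d j - u'| / d j, by positivity, by
        rw [div_mul_cancel₀ _ hj.ne']; exact le_abs_self _⟩
    have h1 := hft' β le_rfl (fun k => q - if k = j then a else 0) (fun k => by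
      split_ifs <;> simp [ha])
    have h2 : ∑ k, (q - if k = j then a else 0) * d k = ∑ k, q * d k - a * d j := by
      simp [sub_mul, Finset.sum_sub_distrib]
    rw [h2] at h1
    linarith
  -- The hyperplane is not vertical: the point mass at `∅` covers nothing, so `c = 0` would give 0 <
  -- u < u' < q ∑ d ≤ 0.
  have hc' : c < 0 := by
    refine lt_of_le_of_ne hc fun h0 => ?_
    have h1 := hfs' ∅
    rw [h0] at h1 hβ
    have h2 : ∑ j, q * d j ≤ 0 := Finset.sum_nonpos fun j _ =>
      mul_nonpos_of_nonneg_of_nonpos hq (hdj j)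
    simp at h1
    linarith
  refine ⟨fun j => ⟨d j / c, div_nonneg_of_nonpos (hdj j) hc⟩, fun T => ?_⟩
  change β + q * ∑ j, d j / c ≤ F T + ∑ j ∈ T, d j / c
  have h1 := hfs' T
  rw [← Finset.mul_sum] at hβ
  rw [← Finset.sum_div, ← Finset.sum_div, ← sub_nonneg]
  have h2 : F T + (∑ j ∈ T, d j) / c - (β + q * ((∑ j, d j) / c)) =
      (F T * c + ∑ j ∈ T, d j - (β * c + q * ∑ j, d j)) / c := by
    have := hc'.ne
    field_simp
  rw [h2]
  exact div_nonneg_of_nonpos (by linarith) hc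

/-! ### Resampling all coordinates but one -/

theorem measurePreserving_swap_coordinate {n : ℕ} {α : Type*} [MeasurableSpace α]
    (D : Fin n → Measure α) [∀ i, IsProbabilityMeasure (D i)] (i : Fin n) :
    MeasurePreserving (fun z : (Fin n → α) × (Fin n → α) =>
        (Function.update z.1 i (z.2 i), Function.update z.2 i (z.1 i)))
      ((Measure.pi D).prod (Measure.pi D)) ((Measure.pi D).prod (Measure.pi D)) := by
  -- A pair of profiles is a profile of independent pairs; the map swaps the pair at `i`, whose two
  -- entries have the same law.
  have h1 := measurePreserving_arrowProdEquivProdArrow α α (Fin n) D D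
  have h2 : MeasurePreserving (fun (a : Fin n → α × α) k => (if k = i then Prod.swap else id) (a k))
      (Measure.pi fun k => (D k).prod (D k)) (Measure.pi fun k => (D k).prod (D k)) := by
    refine measurePreserving_pi (fun k => (D k).prod (D k)) (fun k => (D k).prod (D k))
      (f := fun k => if k = i then Prod.swap else id) fun k => ?_
    split_ifs
    · exact Measure.measurePreserving_swap
    · exact MeasurePreserving.id _
  have h3 := (h1.comp h2).comp (h1.symm (MeasurableEquiv.arrowProdEquivProdArrow α α (Fin n)))
  convert h3 using 1
  funext z
  ext k <;> by_cases hk : k = i <;>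
    simp [MeasurableEquiv.arrowProdEquivProdArrow, Equiv.arrowProdEquivProdArrow, hk]

/-- Resampling the coordinates other than `i` makes a profile independent of anything that does
not depend on coordinate `i`. -/
theorem lintegral_lintegral_update {n : ℕ} {α : Type*} [MeasurableSpace α]
    (D : Fin n → Measure α) [∀ i, IsProbabilityMeasure (D i)] (i : Fin n)
    (H : (Fin n → α) → (Fin n → α) → ℝ≥0∞) (hH : Measurable (Function.uncurry H))
    (hi : ∀ v w a, H (Function.update v i a) w = H v w) :
    ∫⁻ v, ∫⁻ v', H v (Function.update v' i (v i)) ∂(Measure.pi D) ∂(Measure.pi D) =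
      ∫⁻ v, ∫⁻ w, H v w ∂(Measure.pi D) ∂(Measure.pi D) := by
  have hΦ := measurePreserving_swap_coordinate D i
  have h1 := hΦ.lintegral_comp hH
  rw [lintegral_prod _ hH.aemeasurable,
    lintegral_prod (fun z : (Fin n → α) × (Fin n → α) => Function.uncurry H (Function.update z.1 i (z.2 i),
      Function.update z.2 i (z.1 i))) (hH.comp hΦ.measurable).aemeasurable] at h1
  simpa [Function.uncurry, hi] using h1

/-! ### Measurable choice of an optimal allocation -/

theorem measurable_of_measurableSet_fiber {Ω X β : Type*} [MeasurableSpace Ω] [MeasurableSpace β]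
    [Finite X] {g : Ω → X} (hg : ∀ x, MeasurableSet {ω | g ω = x}) {f : X → Ω → β}
    (hf : ∀ x, Measurable (f x)) : Measurable fun ω => f (g ω) ω := by
  intro s hs
  have : (fun ω => f (g ω) ω) ⁻¹' s = ⋃ x, {ω | g ω = x} ∩ f x ⁻¹' s := by
    ext ω
    simp
  rw [this]
  exact MeasurableSet.iUnion fun x => (hg x).inter (hf x hs)

/-- The set of maximizers takes finitely many values, each on a measurable event, so any fixed
choice function applied to it is measurable. -/
theorem exists_measurable_maximizer {Ω X : Type*} [MeasurableSpace Ω] [Finite X]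
    (P : X → Prop) (hP : ∃ x, P x) (f : X → Ω → ℝ≥0) (hf : ∀ x, Measurable (f x)) :
    ∃ g : Ω → X, (∀ x, MeasurableSet {ω | g ω = x}) ∧
      ∀ ω, P (g ω) ∧ ∀ x, P x → f x ω ≤ f (g ω) ω := by
  classical
  have := Fintype.ofFinite X
  let M : Ω → Set X := fun ω => {x | P x ∧ ∀ y, P y → f y ω ≤ f x ω}
  have hM : ∀ ω, (M ω).Nonempty := by
    intro ω
    obtain ⟨x, hx, h⟩ := (Finset.univ.filter P).exists_max_image (f · ω)
      (by obtain ⟨x, hx⟩ := hP; exact ⟨x, by simpa using hx⟩)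
    exact ⟨x, by simpa using hx, fun y hy => h y (by simpa using hy)⟩
  obtain ⟨x₀, -⟩ := hP
  let c : Set X → X := fun s => if h : s.Nonempty then h.some else x₀
  have hmeas : ∀ s : Set X, MeasurableSet {ω | M ω = s} := by
    intro s
    have : {ω | M ω = s} = ⋂ x, {ω | (P x ∧ ∀ y, P y → f y ω ≤ f x ω) ↔ x ∈ s} := by
      ext ω
      simp [M, Set.ext_iff]
    rw [this]
    refine MeasurableSet.iInter fun x => ?_
    have h1 : MeasurableSet {ω | ∀ y, P y → f y ω ≤ f x ω} := by
      simp only [Set.ofPred_forall]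
      exact MeasurableSet.iInter fun y => MeasurableSet.iInter fun _ =>
        measurableSet_le (hf y) (hf x)
    exact ((MeasurableSet.const _).inter h1).iff (MeasurableSet.const _)
  refine ⟨fun ω => c (M ω), fun x => ?_, fun ω => ?_⟩
  · have : {ω | c (M ω) = x} = ⋃ s ∈ {s | c s = x}, {ω | M ω = s} := by
      ext ω
      simp
    rw [this]
    exact MeasurableSet.biUnion (Set.to_countable _) fun s _ => hmeas s
  · have : c (M ω) ∈ M ω := by
      simp only [c, dif_pos (hM ω)]
      exact (hM ω).some_mem
    exact this

theorem measurable_apply {m : ℕ} (S : Finset (Fin m)) :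
    Measurable (fun v : Valuation m => v.1 S) :=
  (measurable_pi_apply S).comp measurable_subtype_coe

theorem measurable_profile_apply {n m : ℕ} (i : Fin n) (S : Finset (Fin m)) :
    Measurable (fun v : Profile n m => (v i).1 S) :=
  (measurable_apply S).comp (measurable_pi_apply i)

theorem measurable_welfare {n m : ℕ} (x : Fin n → Finset (Fin m)) :
    Measurable (fun v : Profile n m => welfare v x) := by
  unfold welfare
  exact Finset.measurable_fun_sum _ fun i _ => measurable_profile_apply i (x i)

theorem exists_optimal_allocation (n m : ℕ) :
    ∃ x : Profile n m → Fin n → Finset (Fin m),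
      (∀ i S, MeasurableSet {v | x v i = S}) ∧ (∀ v, IsAllocation (x v)) ∧
      ∀ v, welfare v (x v) = optWelfare v := by
  obtain ⟨g, hg, h⟩ := exists_measurable_maximizer (Ω := Profile n m)
    (X := Fin n → Finset (Fin m)) IsAllocation ⟨fun _ => ∅, fun _ _ _ => by simp⟩
    (fun x v => welfare v x) measurable_welfare
  refine ⟨g, fun i S => ?_, fun v => (h v).1, fun v => le_antisymm ?_ ?_⟩
  · have : {v | g v i = S} = ⋃ x ∈ {x : Fin n → Finset (Fin m) | x i = S}, {v | g v = x} := by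
      ext v
      simp
    rw [this]
    exact MeasurableSet.biUnion (Set.to_countable _) fun x _ => hg x
  · exact Finset.le_sup (f := fun x => welfare v x) (by simpa using (h v).1)
  · exact Finset.sup_le fun x hx => (h v).2 x (by simpa using hx)

theorem optWelfare_le_sum_univ {n m : ℕ} (v : Profile n m) :
    optWelfare v ≤ ∑ i, (v i).1 Finset.univ :=
  Finset.sup_le fun x _ => Finset.sum_le_sum fun i _ =>
    (v i).2.monotone _ _ (Finset.subset_univ (x i))

theorem IsSubadditiveValuation.le_sum_singleton {m : ℕ} {v : Finset (Fin m) → ℝ≥0}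
    (hv : IsSubadditiveValuation v) (S : Finset (Fin m)) : v S ≤ ∑ j ∈ S, v {j} := by
  induction S using Finset.induction_on with
  | empty => simp [hv.normalized]
  | insert j S hj ih =>
    rw [Finset.sum_insert hj, Finset.insert_eq]
    exact (hv.subadditive _ _).trans (by gcongr)

/-! ### Strategies and the loss from squaring the scale -/

section

/-- A random choice of a set of goods for every buyer, given as a (sub)probability on sets
depending on the profile. Each good of the reference allocation `x` is chosen with probability at
most `q`, and the other goods are never chosen. -/
structure IsStrategy {n m : ℕ} (x : Profile n m → Fin n → Finset (Fin m)) (q : ℝ≥0)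
    (lam : Profile n m → Fin n → Finset (Fin m) → ℝ≥0) : Prop where
  measurable : ∀ i S, Measurable fun w => lam w i S
  total : ∀ w i, ∑ S, lam w i S ≤ 1
  marginal : ∀ w i j, ∑ S, lam w i S * (if j ∈ S then 1 else 0) ≤ if j ∈ x w i then q else 0

/-- The expected welfare of the strategy `lam` if the chosen sets `S` are replaced by `φ S`. -/
noncomputable def strategyWelfare {n m : ℕ} (D : Fin n → Measure (Valuation m))
    (lam : Profile n m → Fin n → Finset (Fin m) → ℝ≥0) (φ : Finset (Fin m) → Finset (Fin m)) :
    ℝ≥0∞ :=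
  ∫⁻ w, ((∑ i, ∑ S, lam w i S * (w i).1 (φ S) : ℝ≥0) : ℝ≥0∞) ∂(Measure.pi D)

variable {n m : ℕ} {x : Profile n m → Fin n → Finset (Fin m)} {q : ℝ≥0}
  {lam : Profile n m → Fin n → Finset (Fin m) → ℝ≥0} {D : Fin n → Measure (Valuation m)}

theorem IsStrategy.measurable_sum (h : IsStrategy x q lam) (φ : Finset (Fin m) → Finset (Fin m)) :
    Measurable fun w => ∑ i, ∑ S, lam w i S * (w i).1 (φ S) :=
  Finset.measurable_fun_sum _ fun i _ => Finset.measurable_fun_sum _ fun S _ =>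
    (h.measurable i S).mul (measurable_profile_apply i (φ S))

theorem IsStrategy.sum_additive_le (h : IsStrategy x q lam) (c : Fin m → ℝ≥0) (w : Profile n m)
    (i : Fin n) : ∑ S, lam w i S * ∑ j ∈ S, c j ≤ q * ∑ j ∈ x w i, c j := by
  calc ∑ S, lam w i S * ∑ j ∈ S, c j
      = ∑ j, (∑ S, lam w i S * (if j ∈ S then 1 else 0)) * c j := by
        simp_rw [Finset.sum_mul]
        rw [Finset.sum_comm]
        refine Finset.sum_congr rfl fun S _ => ?_
        simp [Finset.mul_sum]
    _ ≤ ∑ j, (if j ∈ x w i then q else 0) * c j := by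
        gcongr with j
        exact h.marginal w i j
    _ = _ := by simp [Finset.mul_sum]

/-- Each good of `x w i` contributes at most its singleton value, hence at most the value of `x w
i`, with weight `q`; there are at most `m` such goods. The crude factor `m` is harmless, since it
enters the number of squarings only through its double logarithm. -/
theorem IsStrategy.sum_le (h : IsStrategy x q lam) (w : Profile n m) :
    ∑ i, ∑ S, lam w i S * (w i).1 S ≤ q * m * welfare w (x w) := by
  unfold welfare
  rw [Finset.mul_sum]
  refine Finset.sum_le_sum fun i _ => ?_
  calc ∑ S, lam w i S * (w i).1 S ≤ ∑ S, lam w i S * ∑ j ∈ S, (w i).1 {j} := by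
        gcongr with S
        exact (w i).2.le_sum_singleton S
    _ ≤ q * ∑ j ∈ x w i, (w i).1 {j} := h.sum_additive_le _ w i
    _ ≤ q * ∑ j ∈ x w i, (w i).1 (x w i) := by
        gcongr with j hj
        exact (w i).2.monotone _ _ (by simpa using hj)
    _ ≤ q * m * (w i).1 (x w i) := by
        rw [Finset.sum_const, nsmul_eq_mul, ← mul_assoc]
        gcongr
        simpa using (x w i).card_le_univ

theorem IsStrategy.strategyWelfare_le (h : IsStrategy x q lam) :
    strategyWelfare D lam id ≤ q * m * ∫⁻ w, (welfare w (x w) : ℝ≥0∞) ∂(Measure.pi D) := by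
  rw [← lintegral_const_mul' _ _ (by finiteness)]
  refine lintegral_mono fun w => ?_
  have := h.sum_le w
  dsimp only [id]
  exact_mod_cast this

theorem isStrategy_reference (hx : ∀ i S, MeasurableSet {v | x v i = S}) (hq : q ≤ 1) :
    IsStrategy x q (fun w i S => if x w i = S then q else 0) where
  measurable i S := Measurable.ite (hx i S) measurable_const measurable_const
  total w i := by simpa using hq
  marginal w i j := by
    rw [Finset.sum_eq_single (x w i)] <;> simp +contextual [eq_comm]

theorem strategyWelfare_reference :
    strategyWelfare D (fun w i S => if x w i = S then q else 0) id =
      q * ∫⁻ w, (welfare w (x w) : ℝ≥0∞) ∂(Measure.pi D) := by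
  rw [← lintegral_const_mul' _ _ (by finiteness)]
  refine lintegral_congr fun w => ?_
  simp [welfare, Finset.mul_sum]

/-- The strategy that intersects the chosen set with an independent random set with law `μ`. -/
noncomputable def interStrategy (lam : Profile n m → Fin n → Finset (Fin m) → ℝ≥0)
    (μ : Finset (Fin m) → ℝ≥0) : Profile n m → Fin n → Finset (Fin m) → ℝ≥0 :=
  fun w i R => ∑ T, μ T * ∑ S, if S ∩ T = R then lam w i S else 0

theorem sum_interStrategy (μ : Finset (Fin m) → ℝ≥0) (w : Profile n m) (i : Fin n)
    (g : Finset (Fin m) → ℝ≥0) :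
    ∑ R, interStrategy lam μ w i R * g R = ∑ T, μ T * ∑ S, lam w i S * g (S ∩ T) := by
  unfold interStrategy
  simp_rw [Finset.sum_mul, mul_assoc, Finset.sum_mul]
  rw [Finset.sum_comm]
  refine Finset.sum_congr rfl fun T _ => ?_
  rw [← Finset.mul_sum, Finset.sum_comm]
  simp

/-- Independence multiplies the marginals; with `r = q` this is why the scale gets squared. -/
theorem IsStrategy.inter (h : IsStrategy x q lam) {μ : Finset (Fin m) → ℝ≥0} (hμ : ∑ T, μ T = 1)
    {r : ℝ≥0} (hr : ∀ j, ∑ T, μ T * (if j ∈ T then 1 else 0) ≤ r) :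
    IsStrategy x (r * q) (interStrategy lam μ) where
  measurable i R := by
    unfold interStrategy
    refine Finset.measurable_fun_sum _ fun T _ =>
      (Finset.measurable_fun_sum _ fun S _ => ?_).const_mul _
    split_ifs
    exacts [h.measurable i S, measurable_const]
  total w i := by
    have := sum_interStrategy (lam := lam) μ w i (fun _ => 1)
    simp only [mul_one] at this
    rw [this, ← hμ]
    exact Finset.sum_le_sum fun T _ => mul_le_of_le_one_right' (h.total w i)
  marginal w i j := by
    rw [sum_interStrategy μ w i (fun S => if j ∈ S then 1 else 0)]
    calc ∑ T, μ T * ∑ S, lam w i S * (if j ∈ S ∩ T then 1 else 0)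
        = ∑ T, (μ T * (if j ∈ T then 1 else 0)) * ∑ S, lam w i S * (if j ∈ S then 1 else 0) := by
          refine Finset.sum_congr rfl fun T _ => ?_
          by_cases hj : j ∈ T <;> simp [hj]
      _ ≤ r * (if j ∈ x w i then q else 0) := by
          rw [← Finset.sum_mul]
          gcongr
          exacts [hr j, h.marginal w i j]
      _ = _ := by simp

theorem IsStrategy.strategyWelfare_interStrategy (h : IsStrategy x q lam)
    (μ : Finset (Fin m) → ℝ≥0) :
    strategyWelfare D (interStrategy lam μ) id =
      ∑ T, μ T * strategyWelfare D lam (fun S => S ∩ T) := by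
  unfold strategyWelfare
  simp_rw [id, sum_interStrategy]
  rw [← Finset.sum_congr rfl fun T _ => lintegral_const_mul' (μ T : ℝ≥0∞) _ (by finiteness),
    ← lintegral_finsetSum _ fun T _ =>
      ((h.measurable_sum (fun S => S ∩ T)).coe_nnreal_ennreal.const_mul _)]
  refine lintegral_congr fun w => ?_
  push_cast
  simp_rw [Finset.mul_sum]
  rw [Finset.sum_comm]

theorem IsStrategy.strategyWelfare_le_sdiff_add_inter (h : IsStrategy x q lam)
    (T : Finset (Fin m)) :
    strategyWelfare D lam id ≤
      strategyWelfare D lam (fun S => S \ T) + strategyWelfare D lam (fun S => S ∩ T) := by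
  unfold strategyWelfare
  rw [← lintegral_add_left (h.measurable_sum _).coe_nnreal_ennreal]
  refine lintegral_mono fun w => ?_
  norm_cast
  simp_rw [← Finset.sum_add_distrib, ← mul_add]
  gcongr with i _ S _
  calc (w i).1 (id S) = (w i).1 ((S \ T) ∪ (S ∩ T)) := by rw [Finset.sdiff_union_inter]; rfl
    _ ≤ _ := (w i).2.subadditive _ _

/-- The largest expected welfare of a strategy with marginals at most `q`. -/
noncomputable def supStrategyWelfare (D : Fin n → Measure (Valuation m))
    (x : Profile n m → Fin n → Finset (Fin m)) (q : ℝ≥0) : ℝ≥0∞ :=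
  ⨆ (lam) (_ : IsStrategy x q lam), strategyWelfare D lam id

theorem supStrategyWelfare_le :
    supStrategyWelfare D x q ≤ q * m * ∫⁻ w, (welfare w (x w) : ℝ≥0∞) ∂(Measure.pi D) :=
  iSup₂_le fun _ h => h.strategyWelfare_le

theorem IsStrategy.le_supStrategyWelfare (h : IsStrategy x q lam) :
    strategyWelfare D lam id ≤ supStrategyWelfare D x q :=
  le_iSup₂_of_le lam h le_rfl

/-- Removing an independent random set that contains each good with probability at most `r` costs
at most the largest welfare at the scale `r * q`. -/
theorem IsStrategy.strategyWelfare_le_sum_sdiff (h : IsStrategy x q lam)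
    {μ : Finset (Fin m) → ℝ≥0} (hμ : ∑ T, μ T = 1) {r : ℝ≥0}
    (hr : ∀ j, ∑ T, μ T * (if j ∈ T then 1 else 0) ≤ r) :
    strategyWelfare D lam id ≤ ∑ T, μ T * strategyWelfare D lam (fun S => S \ T) +
      supStrategyWelfare D x (r * q) := by
  calc strategyWelfare D lam id = ∑ T, (μ T : ℝ≥0∞) * strategyWelfare D lam id := by
        rw [← Finset.sum_mul]
        norm_cast
        rw [hμ]
        simp
    _ ≤ ∑ T, (μ T : ℝ≥0∞) * (strategyWelfare D lam (fun S => S \ T) +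
          strategyWelfare D lam (fun S => S ∩ T)) := by
        gcongr with T
        exact h.strategyWelfare_le_sdiff_add_inter T
    _ = ∑ T, μ T * strategyWelfare D lam (fun S => S \ T) +
          strategyWelfare D (interStrategy lam μ) id := by
        simp_rw [h.strategyWelfare_interStrategy, mul_add, Finset.sum_add_distrib]
    _ ≤ _ := by
        gcongr
        exact (h.inter hμ hr).le_supStrategyWelfare

/-- Among the scales `2 ^ (-2 ^ k)`, `k < K`, there is one at which squaring the scale loses a
`1 / (8 K)` fraction of the optimum. -/
theorem exists_strategy_gap (hx : ∀ i S, MeasurableSet {v | x v i = S}) {K : ℕ} (hK : 0 < K)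
    (hm : 4 * m ≤ 2 ^ 2 ^ K)
    (h0 : ∫⁻ w, (welfare w (x w) : ℝ≥0∞) ∂(Measure.pi D) ≠ 0)
    (htop : ∫⁻ w, (welfare w (x w) : ℝ≥0∞) ∂(Measure.pi D) ≠ ∞) :
    ∃ (q : ℝ≥0) (lam : Profile n m → Fin n → Finset (Fin m) → ℝ≥0), IsStrategy x q lam ∧
      supStrategyWelfare D x (q * q) +
        (∫⁻ w, (welfare w (x w) : ℝ≥0∞) ∂(Measure.pi D)) / (8 * K) < strategyWelfare D lam id := by
  set O := ∫⁻ w, (welfare w (x w) : ℝ≥0∞) ∂(Measure.pi D)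
  let s : ℕ → ℝ≥0 := fun k => (1 / 2) ^ 2 ^ k
  have hs : ∀ k, s (k + 1) = s k * s k := fun k => by
    simp only [s, pow_succ 2 k, mul_two, pow_add]
  suffices ∃ k, supStrategyWelfare D x (s (k + 1)) + O / (8 * K) < supStrategyWelfare D x (s k) by
    obtain ⟨k, hk⟩ := this
    obtain ⟨lam, hlam⟩ := lt_iSup_iff.1 hk
    obtain ⟨h, hlam⟩ := lt_iSup_iff.1 hlam
    exact ⟨s k, lam, h, hs k ▸ hlam⟩
  -- Without a gap, the `K` losses add up to at most O/8, and O/2 ≤ O/4 + O/8 is false for 0 < O <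
  -- ∞.
  by_contra! hcon
  have hind : ∀ k, supStrategyWelfare D x (s 0) ≤
      supStrategyWelfare D x (s k) + k * (O / (8 * K)) := by
    intro k
    induction k with
    | zero => simp
    | succ k ih =>
      refine ih.trans ((add_le_add_left (hcon k) _).trans ?_)
      push_cast
      rw [add_mul, one_mul, add_assoc, add_comm (O / (8 * K))]
  have hlow : ((1 / 2 : ℝ≥0) : ℝ≥0∞) * O ≤ supStrategyWelfare D x (s 0) := by
    have h1 : (1 / 2 : ℝ≥0) ≤ 1 := by
      rw [← NNReal.coe_le_coe]; norm_num
    have h2 := (isStrategy_reference hx h1).le_supStrategyWelfare (D := D)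
    rw [strategyWelfare_reference] at h2
    simpa [s] using h2
  have hup : supStrategyWelfare D x (s K) ≤ ((1 / 4 : ℝ≥0) : ℝ≥0∞) * O := by
    refine supStrategyWelfare_le.trans ?_
    gcongr
    norm_cast
    have h1 : (4 * m : ℝ≥0) ≤ 2 ^ 2 ^ K := by exact_mod_cast hm
    simp only [s]
    rw [div_pow, one_pow, div_mul_eq_mul_div, one_mul, div_le_div_iff₀ (by positivity) (by norm_num)]
    linarith
  have h1 := hlow.trans ((hind K).trans (add_le_add_left hup _))
  clear_value O
  lift O to ℝ≥0 using htop
  have hK' : (8 * (K : ℝ≥0)) ≠ 0 := by positivity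
  have h2 : ((8 * K : ℝ≥0) : ℝ≥0∞) = 8 * K := by push_cast; rfl
  rw [← h2, ← ENNReal.coe_div hK'] at h1
  norm_cast at h1
  rw [← NNReal.coe_le_coe] at h1
  push_cast at h1
  have hK'' : (0 : ℝ) < K := by exact_mod_cast hK
  have h3 : (K : ℝ) * (O / (8 * K)) = O / 8 := by field_simp
  rw [h3] at h1
  have h4 : (0 : ℝ) < O := by
    have : O ≠ 0 := by simpa using h0
    positivity
  linarith

end

/-! ### Supporting prices and the welfare of the mechanism -/

section

variable {n m : ℕ} {x : Profile n m → Fin n → Finset (Fin m)} {q : ℝ≥0}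
  {lam : Profile n m → Fin n → Finset (Fin m) → ℝ≥0} {D : Fin n → Measure (Valuation m)}
  {p : Fin m → ℝ≥0} {σ : Equiv.Perm (Fin n)} {alg : Profile n m → Fin n → Finset (Fin m)}

theorem sum_biUnion_le_sum_sum {ι κ : Type*} [DecidableEq κ] (s : Finset ι) (t : ι → Finset κ)
    (f : κ → ℝ≥0) : ∑ j ∈ s.biUnion t, f j ≤ ∑ i ∈ s, ∑ j ∈ t i, f j := by
  classical
  induction s using Finset.induction_on with
  | empty => simp
  | insert i s hi ih =>
    rw [Finset.biUnion_insert, Finset.sum_insert hi]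
    refine le_trans ?_ (add_le_add_right ih _)
    rw [← Finset.sum_union_inter]
    exact le_add_of_nonneg_right zero_le

/-- A strategy whose welfare exceeds the best welfare at the squared scale by more than `δ` is
supported by static prices. -/
theorem IsStrategy.exists_prices (h : IsStrategy x q lam)
    (htop : ∫⁻ w, (welfare w (x w) : ℝ≥0∞) ∂(Measure.pi D) ≠ ∞) {δ : ℝ≥0∞}
    (hδ : supStrategyWelfare D x (q * q) + δ < strategyWelfare D lam id) :
    ∃ p : Fin m → ℝ≥0, ∀ T : Finset (Fin m), δ + ((q * ∑ j, p j : ℝ≥0) : ℝ≥0∞) ≤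
      strategyWelfare D lam (fun S => S \ T) + ((∑ j ∈ T, p j : ℝ≥0) : ℝ≥0∞) := by
  have hsup : ∀ r : ℝ≥0, supStrategyWelfare D x r ≠ ∞ := fun r =>
    ne_top_of_le_ne_top (by finiteness) supStrategyWelfare_le
  have hδ' : δ ≠ ∞ := by
    rintro rfl
    simp at hδ
  have hF : ∀ T, strategyWelfare D lam (fun S => S \ T) ≠ ∞ := fun T => by
    refine ne_top_of_le_ne_top (hsup q) (le_trans (lintegral_mono fun w => ?_)
      h.le_supStrategyWelfare)
    gcongr with i _ S _
    exact (w i).2.monotone _ _ Finset.sdiff_subset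
  obtain ⟨p, hp⟩ := exists_prices_of_forall_lt
    (fun T => (strategyWelfare D lam (fun S => S \ T)).toReal) (q := q) (β := δ.toReal) q.2
    (fun μ hμ hμq => by
      let μ' : Finset (Fin m) → ℝ≥0 := fun T => ⟨μ T, hμ.1 T⟩
      have h1 : ∑ T, μ' T = 1 := by
        rw [← NNReal.coe_inj, NNReal.coe_sum]
        exact hμ.2
      have h2 : ∀ j, ∑ T, μ' T * (if j ∈ T then 1 else 0) ≤ q := fun j => by
        rw [← NNReal.coe_le_coe]
        simp only [NNReal.coe_sum, NNReal.coe_mul, apply_ite ((↑) : ℝ≥0 → ℝ), NNReal.coe_one,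
          NNReal.coe_zero]
        exact hμq j
      have h3 := hδ.trans_le (h.strategyWelfare_le_sum_sdiff h1 h2)
      -- Cancelling the supremum at scale `q * q` is legitimate because it is finite.
      rw [add_comm, ENNReal.add_lt_add_iff_right (hsup _)] at h3
      have h4 : ∀ T ∈ Finset.univ, (μ' T : ℝ≥0∞) * strategyWelfare D lam (fun S => S \ T) ≠ ∞ :=
        fun T _ => ENNReal.mul_ne_top ENNReal.coe_ne_top (hF T)
      have h5 := (ENNReal.toReal_lt_toReal hδ' (ENNReal.sum_ne_top.2 h4)).2 h3
      rw [ENNReal.toReal_sum h4] at h5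
      simp only [ENNReal.toReal_mul, ENNReal.coe_toReal] at h5
      exact h5)
  refine ⟨p, fun T => ?_⟩
  have := hF T
  rw [← ENNReal.toReal_le_toReal (by finiteness) (by finiteness),
    ENNReal.toReal_add hδ' (by finiteness), ENNReal.toReal_add (hF T) (by finiteness)]
  simpa only [ENNReal.coe_toReal, NNReal.coe_mul, NNReal.coe_sum] using hp T

theorem IsPostedPriceOutcome.measurableSet_eq (h : IsPostedPriceOutcome p σ alg)
    (X : Fin n → Finset (Fin m)) : MeasurableSet {v | alg v = X} := by
  have : {v | alg v = X} = ⋂ i, {v | alg v i = X i} := by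
    ext v
    simp [funext_iff]
  rw [this]
  exact MeasurableSet.iInter fun i => h.measurable i (X i)

/-- Only purchases of earlier buyers matter, and these are made before the valuation of `i` is seen.
-/
theorem IsPostedPriceOutcome.unsold_update (h : IsPostedPriceOutcome p σ alg) (v : Profile n m)
    (i : Fin n) (a : Valuation m) :
    unsold σ (alg (Function.update v i a)) i = unsold σ (alg v) i := by
  unfold unsold
  refine Finset.filter_congr fun j _ => forall₂_congr fun k hk => ?_
  rw [h.online (Function.update v i a) v k fun l hl => ?_]
  rw [Function.update_of_ne]
  rintro rfl
  exact absurd hk (not_lt.2 hl)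

/-- The welfare inequality for a set of unsold goods. -/
theorem IsPostedPriceOutcome.apply_add_price_le (h : IsPostedPriceOutcome p σ alg)
    (v : Profile n m) (i : Fin n) {S : Finset (Fin m)} (hS : S ⊆ unsold σ (alg v) i) :
    (v i).1 S + ∑ j ∈ alg v i, p j ≤ (v i).1 (alg v i) + ∑ j ∈ S, p j := by
  have := h.maximizes v i S hS
  unfold utility at this
  rw [← NNReal.coe_le_coe]
  push_cast
  linarith

theorem IsPostedPriceOutcome.price_le (h : IsPostedPriceOutcome p σ alg)
    (v : Profile n m) (i : Fin n) : ∑ j ∈ alg v i, p j ≤ (v i).1 (alg v i) := by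
  simpa [(v i).2.normalized] using h.apply_add_price_le v i (Finset.empty_subset _)

/-- The buyer's choice is at least as good as a random choice among the unsold goods. -/
theorem IsPostedPriceOutcome.sum_apply_inter_add_price_le (h : IsPostedPriceOutcome p σ alg)
    (v : Profile n m) (i : Fin n) {l : Finset (Fin m) → ℝ≥0} (hl : ∑ S, l S ≤ 1) :
    ∑ S, l S * (v i).1 (S ∩ unsold σ (alg v) i) + ∑ j ∈ alg v i, p j ≤
      (v i).1 (alg v i) + ∑ S, l S * ∑ j ∈ S, p j := by
  have h1 : ∑ S, l S * ((v i).1 (S ∩ unsold σ (alg v) i) + ∑ j ∈ alg v i, p j) ≤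
      ∑ S, l S * ((v i).1 (alg v i) + ∑ j ∈ S, p j) := by
    refine Finset.sum_le_sum fun S _ => mul_le_mul_of_nonneg_left ?_ zero_le
    refine (h.apply_add_price_le v i Finset.inter_subset_right).trans ?_
    gcongr
    exact Finset.inter_subset_left
  simp_rw [mul_add, Finset.sum_add_distrib, ← Finset.sum_mul] at h1
  have h2 := h.price_le v i
  rw [← NNReal.coe_le_coe] at h1 h2 hl ⊢
  push_cast at h1 h2 hl ⊢
  -- The missing mass `1 - ∑ l` stands for buying nothing, which is no better than the actual choice
  -- since its utility is nonnegative.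
  nlinarith [mul_le_mul_of_nonneg_left h2 (sub_nonneg.2 hl)]

/-- Apply the pointwise comparison with the strategy evaluated at a profile that keeps the valuation
of `i` and resamples the others. Since the unsold set ignores the valuation of `i`, integration
decouples it from the strategy's profile. Revenue is added on the left instead of subtracted on the
right, to stay in `ℝ≥0∞`. -/
theorem IsPostedPriceOutcome.lintegral_buyer_le (h : IsPostedPriceOutcome p σ alg)
    [∀ i, IsProbabilityMeasure (D i)] (hlam : IsStrategy x q lam) (i : Fin n) :
    ∫⁻ v, ∫⁻ w, ((∑ S, lam w i S * (w i).1 (S ∩ unsold σ (alg v) i) : ℝ≥0) : ℝ≥0∞)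
        ∂(Measure.pi D) ∂(Measure.pi D) +
      ∫⁻ v, ((∑ j ∈ alg v i, p j : ℝ≥0) : ℝ≥0∞) ∂(Measure.pi D) ≤
    ∫⁻ v, ((v i).1 (alg v i) : ℝ≥0∞) ∂(Measure.pi D) +
      ∫⁻ w, ((∑ S, lam w i S * ∑ j ∈ S, p j : ℝ≥0) : ℝ≥0∞) ∂(Measure.pi D) := by
  let G : (Fin n → Finset (Fin m)) → Profile n m → ℝ≥0 := fun X w =>
    ∑ S, lam w i S * (w i).1 (S ∩ unsold σ X i)
  have hG : ∀ X, Measurable (G X) := fun X => Finset.measurable_fun_sum _ fun S _ =>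
    (hlam.measurable i S).mul (measurable_profile_apply i _)
  let P : Profile n m → ℝ≥0 := fun w => ∑ S, lam w i S * ∑ j ∈ S, p j
  have hP : Measurable P := Finset.measurable_fun_sum _ fun S _ =>
    (hlam.measurable i S).mul_const _
  have hG' : Measurable fun z : Profile n m × Profile n m => (G (alg z.1) z.2 : ℝ≥0∞) :=
    (measurable_of_measurableSet_fiber (g := fun z : Profile n m × Profile n m => alg z.1)
      (fun X => measurable_fst (h.measurableSet_eq X))
      (f := fun X z => G X z.2) (fun X => (hG X).comp measurable_snd)).coe_nnreal_ennreal
  have hpay : Measurable fun v => ((∑ j ∈ alg v i, p j : ℝ≥0) : ℝ≥0∞) :=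
    (measurable_of_measurableSet_fiber (h.measurable i)
      (f := fun S _ => ∑ j ∈ S, p j) fun S => measurable_const).coe_nnreal_ennreal
  have hval : Measurable fun v : Profile n m => ((v i).1 (alg v i) : ℝ≥0∞) :=
    (measurable_of_measurableSet_fiber (h.measurable i)
      (f := fun S v => (v i).1 S) fun S => measurable_profile_apply i S).coe_nnreal_ennreal
  have e1 := lintegral_lintegral_update D i (fun v w => (G (alg v) w : ℝ≥0∞)) hG' (fun v w a => by
    simp only [G, h.unsold_update])
  have e2 := lintegral_lintegral_update D i (fun _ w => (P w : ℝ≥0∞))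
    (hP.coe_nnreal_ennreal.comp measurable_snd) (fun _ _ _ => rfl)
  rw [lintegral_const, measure_univ, mul_one] at e2
  change ∫⁻ v, ∫⁻ w, (G (alg v) w : ℝ≥0∞) ∂(Measure.pi D) ∂(Measure.pi D) + _ ≤
    _ + ∫⁻ w, (P w : ℝ≥0∞) ∂(Measure.pi D)
  rw [← e1, ← e2, ← lintegral_add_right _ hpay, ← lintegral_add_left hval]
  refine lintegral_mono fun v => ?_
  have hone : ∀ c : ℝ≥0∞, c = ∫⁻ _, c ∂(Measure.pi D) := fun c => by simp
  have hupd : Measurable fun v' : Profile n m => Function.update v' i (v i) :=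
    measurable_update'.comp (measurable_id.prodMk measurable_const)
  rw [hone (((∑ j ∈ alg v i, p j : ℝ≥0) : ℝ≥0∞)), hone ((v i).1 (alg v i) : ℝ≥0∞),
    ← lintegral_add_right _ measurable_const, ← lintegral_add_left measurable_const]
  refine lintegral_mono fun v' => ?_
  have := h.sum_apply_inter_add_price_le v i (hlam.total (Function.update v' i (v i)) i)
  simp only [G, P, Function.update_self]
  exact_mod_cast this

theorem IsPostedPriceOutcome.le_lintegral_welfare (h : IsPostedPriceOutcome p σ alg)
    [∀ i, IsProbabilityMeasure (D i)] (hlam : IsStrategy x q lam) (hx : ∀ v, IsAllocation (x v))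
    {δ : ℝ≥0∞} (hp : ∀ T : Finset (Fin m), δ + ((q * ∑ j, p j : ℝ≥0) : ℝ≥0∞) ≤
      strategyWelfare D lam (fun S => S \ T) + ((∑ j ∈ T, p j : ℝ≥0) : ℝ≥0∞)) :
    δ ≤ ∫⁻ v, (welfare v (alg v) : ℝ≥0∞) ∂(Measure.pi D) := by
  have hpay : ∀ i, Measurable fun v => ((∑ j ∈ alg v i, p j : ℝ≥0) : ℝ≥0∞) := fun i =>
    (measurable_of_measurableSet_fiber (h.measurable i)
      (f := fun S _ => ∑ j ∈ S, p j) fun S => measurable_const).coe_nnreal_ennreal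
  have hval : ∀ i, Measurable fun v : Profile n m => ((v i).1 (alg v i) : ℝ≥0∞) := fun i =>
    (measurable_of_measurableSet_fiber (h.measurable i)
      (f := fun S v => (v i).1 S) fun S => measurable_profile_apply i S).coe_nnreal_ennreal
  have hG : ∀ i X, Measurable fun w : Profile n m =>
      ((∑ S, lam w i S * (w i).1 (S ∩ unsold σ X i) : ℝ≥0) : ℝ≥0∞) := fun i X =>
    (Finset.measurable_fun_sum _ fun S _ =>
      (hlam.measurable i S).mul (measurable_profile_apply i _)).coe_nnreal_ennreal
  have hP : ∀ i, Measurable fun w => ((∑ S, lam w i S * ∑ j ∈ S, p j : ℝ≥0) : ℝ≥0∞) := fun i =>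
    (Finset.measurable_fun_sum _ fun S _ => (hlam.measurable i S).mul_const _).coe_nnreal_ennreal
  have hlow : δ + ((q * ∑ j, p j : ℝ≥0) : ℝ≥0∞) ≤
      ∑ i, (∫⁻ v, ∫⁻ w, ((∑ S, lam w i S * (w i).1 (S ∩ unsold σ (alg v) i) : ℝ≥0) : ℝ≥0∞)
        ∂(Measure.pi D) ∂(Measure.pi D) +
      ∫⁻ v, ((∑ j ∈ alg v i, p j : ℝ≥0) : ℝ≥0∞) ∂(Measure.pi D)) := by
    simp_rw [← lintegral_add_right _ (hpay _)]
    rw [← lintegral_finsetSum]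
    · rw [← mul_one (δ + _), ← measure_univ (μ := Measure.pi D), ← lintegral_const]
      -- The price inequality is used pointwise in `v`, with T the set of all goods ever sold; the
      -- unsold goods at each arrival contain its complement.
      refine lintegral_mono fun v => (hp (Finset.univ.biUnion (alg v))).trans ?_
      rw [Finset.sum_add_distrib, ← lintegral_finsetSum _ fun i _ => hG i (alg v)]
      refine add_le_add (lintegral_mono fun w => ?_) ?_
      · norm_cast
        gcongr with i _ S _
        refine (w i).2.monotone _ _ fun j hj => ?_
        simp only [Finset.mem_sdiff, Finset.mem_biUnion, Finset.mem_univ, true_and,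
          not_exists] at hj
        simpa [unsold, hj.1] using fun k _ => hj.2 k
      · norm_cast
        exact sum_biUnion_le_sum_sum _ _ _
    · intro i _
      refine Measurable.add ?_ (hpay i)
      exact measurable_of_measurableSet_fiber h.measurableSet_eq
        (f := fun X _ => ∫⁻ w, ((∑ S, lam w i S * (w i).1 (S ∩ unsold σ X i) : ℝ≥0) : ℝ≥0∞)
          ∂(Measure.pi D)) fun X => measurable_const
  have hup : ∑ i, ∫⁻ w, ((∑ S, lam w i S * ∑ j ∈ S, p j : ℝ≥0) : ℝ≥0∞) ∂(Measure.pi D) ≤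
      ((q * ∑ j, p j : ℝ≥0) : ℝ≥0∞) := by
    rw [← lintegral_finsetSum _ fun i _ => hP i, ← mul_one ((q * _ : ℝ≥0) : ℝ≥0∞),
      ← measure_univ (μ := Measure.pi D), ← lintegral_const]
    refine lintegral_mono fun w => ?_
    dsimp only
    norm_cast
    calc ∑ i, ∑ S, lam w i S * ∑ j ∈ S, p j ≤ ∑ i, q * ∑ j ∈ x w i, p j :=
          Finset.sum_le_sum fun i _ => hlam.sum_additive_le p w i
      _ = q * ∑ j ∈ Finset.univ.biUnion (x w), p j := by
          rw [← Finset.mul_sum, Finset.sum_biUnion fun i _ k _ hik => hx w i k hik]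
      _ ≤ q * ∑ j, p j := by
          gcongr
          exact Finset.subset_univ _
  have hmain := hlow.trans (Finset.sum_le_sum fun i _ => h.lintegral_buyer_le hlam i)
  rw [Finset.sum_add_distrib, ← lintegral_finsetSum _ fun i _ => hval i] at hmain
  have := hmain.trans (add_le_add_right hup _)
  -- The strategy's expected payments, at most q p(M), cancel against the same term in the price
  -- inequality.
  rw [ENNReal.add_le_add_iff_right ENNReal.coe_ne_top] at this
  simpa [welfare] using this

/-! ### Infinite expected optimum -/

/-- If the optimum is infinite, then some buyer has infinite expected value, and a high enough
uniform price reserves all goods for this buyer with positive probability. -/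
theorem exists_prices_of_lintegral_eq_top [∀ i, IsProbabilityMeasure (D i)]
    (htop : ∫⁻ v, (optWelfare v : ℝ≥0∞) ∂(Measure.pi D) = ∞) :
    ∃ p : Fin m → ℝ≥0, ∀ (σ : Equiv.Perm (Fin n))
      (alg : Profile n m → Fin n → Finset (Fin m)), IsPostedPriceOutcome p σ alg →
        ∫⁻ v, (welfare v (alg v) : ℝ≥0∞) ∂(Measure.pi D) = ∞ := by
  obtain ⟨i, hi⟩ : ∃ i, ∫⁻ v : Profile n m, ((v i).1 Finset.univ : ℝ≥0∞) ∂(Measure.pi D) = ∞ := by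
    by_contra! hcon
    refine (ENNReal.sum_ne_top (s := Finset.univ)).2 (fun i _ => hcon i) (top_unique ?_)
    rw [← htop, ← lintegral_finsetSum _ fun i _ =>
      (measurable_profile_apply i Finset.univ).coe_nnreal_ennreal]
    refine lintegral_mono fun v => ?_
    dsimp only
    exact_mod_cast optWelfare_le_sum_univ v
  let E : ℕ → Set (Profile n m) := fun c => {v | ∀ k, k ≠ i → (v k).1 Finset.univ < c}
  have hEmeas : ∀ c, MeasurableSet (E c) := fun c => by
    simp only [E, Set.ofPred_forall]
    exact MeasurableSet.iInter fun k => MeasurableSet.iInter fun _ =>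
      measurableSet_lt (measurable_profile_apply k _) measurable_const
  -- The events `E c` exhaust the space, so one of them is not null.
  obtain ⟨c, hc⟩ : ∃ c, Measure.pi D (E c) ≠ 0 := by
    by_contra! hcon
    have h1 := measure_iUnion_null hcon
    have h2 : ⋃ c, E c = Set.univ := by
      refine Set.eq_univ_of_forall fun v => Set.mem_iUnion.2 ?_
      obtain ⟨c, hc⟩ := exists_nat_gt (∑ k, (v k).1 Finset.univ)
      exact ⟨c, fun k _ => (Finset.single_le_sum
        (f := fun k => (v k).1 Finset.univ) (fun _ _ => zero_le) (Finset.mem_univ k)).trans_lt hc⟩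
    rw [h2, measure_univ] at h1
    exact one_ne_zero h1
  refine ⟨fun _ => c, fun σ alg h => ?_⟩
  have hbuy : ∀ v ∈ E c, ∀ k, k ≠ i → alg v k = ∅ := by
    intro v hv k hk
    by_contra hne
    have h1 := h.price_le v k
    have h2 : 1 ≤ (alg v k).card := Finset.card_pos.2 (Finset.nonempty_iff_ne_empty.2 hne)
    have h3 : (c : ℝ≥0) ≤ ∑ j ∈ alg v k, (c : ℝ≥0) := by
      rw [Finset.sum_const, nsmul_eq_mul]
      exact le_mul_of_one_le_left' (by exact_mod_cast h2)
    exact absurd (h3.trans (h1.trans ((v k).2.monotone _ _ (Finset.subset_univ _))))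
      (not_le.2 (hv k hk))
  have hpt : ∀ v, (E c).indicator 1 v * ((v i).1 Finset.univ : ℝ≥0∞) ≤
      welfare v (alg v) + ((m * c : ℝ≥0) : ℝ≥0∞) := by
    intro v
    by_cases hv : v ∈ E c
    · have hun : unsold σ (alg v) i = Finset.univ := by
        refine Finset.filter_true_of_mem fun j _ k hk => ?_
        rw [hbuy v hv k (by rintro rfl; exact lt_irrefl _ hk)]
        simp
      have h1 := h.apply_add_price_le v i (S := Finset.univ) hun.ge
      have h2 : (v i).1 (alg v i) ≤ welfare v (alg v) :=
        Finset.single_le_sum (f := fun k => (v k).1 (alg v k)) (fun _ _ => zero_le)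
          (Finset.mem_univ i)
      simp only [Finset.sum_const, Finset.card_univ, Fintype.card_fin, nsmul_eq_mul] at h1
      rw [Set.indicator_of_mem hv, Pi.one_apply, one_mul]
      exact_mod_cast (le_add_of_nonneg_right zero_le).trans (h1.trans (add_le_add_left h2 _))
    · simp [Set.indicator_of_notMem hv]
  have hval := (measurable_profile_apply (n := n) (m := m) i Finset.univ).coe_nnreal_ennreal
  have hind : Measurable ((E c).indicator (1 : Profile n m → ℝ≥0∞)) :=
    measurable_one.indicator (hEmeas c)
  -- `E c` ignores coordinate `i`, so the integral factors into a positive probability times an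
  -- infinite expectation.
  have hprod := lintegral_lintegral_update D i
    (fun v w => (E c).indicator 1 v * ((w i).1 Finset.univ : ℝ≥0∞))
    ((hind.comp measurable_fst).mul (hval.comp measurable_snd)) (fun v w a => by
      congr 1
      refine Set.indicator_eq_indicator (by
        simp +contextual [E, Function.update_of_ne]) rfl)
  simp only [Function.update_self, lintegral_const, measure_univ, mul_one] at hprod
  simp_rw [lintegral_const_mul _ hval, hi] at hprod
  rw [lintegral_mul_const _ hind, lintegral_indicator_one (hEmeas c), ENNReal.mul_top hc] at hprod
  have hfin := (hprod.symm.le).trans (lintegral_mono hpt)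
  rw [lintegral_add_right _ measurable_const, lintegral_const, measure_univ, mul_one,
    top_le_iff, ENNReal.add_eq_top] at hfin
  exact hfin.resolve_right ENNReal.coe_ne_top

/-! ### Bounding the number of squarings -/

/-- The number of squarings from `1 / 2` to below `1 / (4 m)` is `O(log log m)`. -/
theorem exists_le_two_pow_two_pow (m : ℕ) :
    ∃ K : ℕ, 0 < K ∧ 4 * m ≤ 2 ^ 2 ^ K ∧
      (K : ℝ) ≤ 6 * max 1 (Real.log (Real.log (m : ℝ))) := by
  rcases lt_or_ge m 4 with hm | hm
  · refine ⟨2, by norm_num, by norm_num; omega, ?_⟩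
    have := le_max_left 1 (Real.log (Real.log (m : ℝ)))
    push_cast
    linarith
  set a := Nat.clog 2 (Nat.clog 2 (4 * m)) with ha
  have h1 : 4 * m ≤ 2 ^ 2 ^ a :=
    (Nat.le_pow_clog one_lt_two _).trans
      (Nat.pow_le_pow_right two_pos (Nat.le_pow_clog one_lt_two _))
  have hc : 1 < Nat.clog 2 (4 * m) := (Nat.lt_clog_iff_pow_lt one_lt_two).2 (by omega)
  have ha0 : 0 < a := Nat.clog_pos one_lt_two hc
  refine ⟨a, ha0, h1, ?_⟩
  obtain ⟨b, hb⟩ := Nat.exists_eq_succ_of_ne_zero ha0.ne'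
  have h2 : 2 ^ 2 ^ b < 4 * m := by
    rw [← Nat.lt_clog_iff_pow_lt one_lt_two, ← Nat.lt_clog_iff_pow_lt one_lt_two, ← ha, hb]
    exact Nat.lt_succ_self b
  have hm0 : (4 : ℝ) ≤ m := by exact_mod_cast hm
  -- Here `4 ≤ m` absorbs the factor 4, so that the first logarithm yields a multiple of log m.
  have h3 : (2 : ℝ) ^ 2 ^ b < m ^ 2 := by
    have : (2 : ℝ) ^ 2 ^ b < 4 * m := by exact_mod_cast h2
    nlinarith
  have h4 := Real.log_lt_log (by positivity) h3
  rw [Real.log_pow, Real.log_pow] at h4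
  push_cast at h4
  have hl2 := Real.log_two_gt_d9
  have h5 : (2 : ℝ) ^ b < 2 ^ 2 * Real.log m := by
    have : (0 : ℝ) < 2 ^ b := by positivity
    nlinarith
  have hlm : 0 < Real.log m := Real.log_pos (by linarith)
  have h6 := Real.log_lt_log (by positivity) h5
  rw [Real.log_mul (by norm_num) hlm.ne', Real.log_pow, Real.log_pow] at h6
  push_cast at h6
  have hL1 := le_max_left 1 (Real.log (Real.log (m : ℝ)))
  have hL2 := le_max_right 1 (Real.log (Real.log (m : ℝ)))
  rw [hb]
  push_cast
  by_cases hb2 : (b : ℝ) ≤ 2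
  · linarith
  · nlinarith

end

end Auction

/-! ### The theorem -/

open Auction in
theorem theorem1 :
    ∃ C : ℝ, 0 < C ∧
      ∀ (n m : ℕ) (D : Fin n → Measure (Auction.Valuation m)),
        (∀ i, IsProbabilityMeasure (D i)) →
        ∃ p : Fin m → ℝ≥0,
          ∀ (σ : Equiv.Perm (Fin n)) (alg : Auction.Profile n m → Fin n → Finset (Fin m)),
            Auction.IsPostedPriceOutcome p σ alg →
            ∫⁻ v, (Auction.optWelfare v : ℝ≥0∞) ∂(Measure.pi D) ≤
              ENNReal.ofReal (C * max 1 (Real.log (Real.log (m : ℝ)))) *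
                ∫⁻ v, (Auction.welfare v (alg v) : ℝ≥0∞) ∂(Measure.pi D) := by
  -- 48 = 8 · 6: the gap is O/(8K), and K is at most 6 max(1, log log m).
  refine ⟨48, by norm_num, fun n m D hD => ?_⟩
  by_cases htop : ∫⁻ v, (optWelfare v : ℝ≥0∞) ∂(Measure.pi D) = ∞
  · obtain ⟨p, hp⟩ := exists_prices_of_lintegral_eq_top htop
    refine ⟨p, fun σ alg h => ?_⟩
    rw [hp σ alg h, ENNReal.mul_top]
    · exact le_top
    · rw [← pos_iff_ne_zero, ENNReal.ofReal_pos]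
      positivity
  by_cases h0 : ∫⁻ v, (optWelfare v : ℝ≥0∞) ∂(Measure.pi D) = 0
  · exact ⟨0, fun σ alg _ => by rw [h0]; exact zero_le⟩
  obtain ⟨x, hxm, hxa, hxo⟩ := exists_optimal_allocation n m
  simp_rw [← hxo] at h0 htop ⊢
  obtain ⟨K, hK, hm, hKm⟩ := exists_le_two_pow_two_pow m
  obtain ⟨q, lam, hlam, hgap⟩ := exists_strategy_gap hxm hK hm h0 htop
  obtain ⟨p, hp⟩ := hlam.exists_prices htop hgap
  refine ⟨p, fun σ alg h => ?_⟩
  have hmain := h.le_lintegral_welfare hlam hxa hp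
  have h8K : (8 * K : ℝ≥0∞) ≤ ENNReal.ofReal (48 * max 1 (Real.log (Real.log (m : ℝ)))) := by
    have : (8 * K : ℝ≥0∞) = ENNReal.ofReal (8 * K) := by
      rw [ENNReal.ofReal_mul (by norm_num)]
      simp
    rw [this]
    exact ENNReal.ofReal_le_ofReal (by linarith)
  refine le_trans ?_ (mul_le_mul' h8K hmain)
  rw [ENNReal.mul_div_cancel (by simp [hK.ne']) (by finiteness)]
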